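/- Let $m \ge 1$ and let $\mathcal A=\bigoplus_{r\in\mathbb Z/m\mathbb Z}\mathcal A_r$ be a $\mathbb Z/m\mathbb Z$-graded Frobenius $\star$-algebra. That is, $\mathcal A$ is a finite-dimensional associative unital $\mathbb Z/m\mathbb Z$-graded $\mathbb C$-algebra with a conjugate-linear involutive anti-automorphism $\star$ such that $(\mathcal A_r)^\star\subseteq\mathcal A_{-r}$ for all $r$, together with a linear functional $\lambda_0:\mathcal A_0\to\mathbb C$ satisfying $\lambda_0(ab)=\lambda_0(ba)$ for all $a,b\in\mathcal A_0$, such that, for the extension $\lambda$ of $\lambda_0$ to $\mathcal A$ by zero on $\mathcal A_r$, $r\neq 0$, the form $\langle a,b\rangle=\lambda(ab^\star)$ is a positive definite Hermitian form on $\mathcal A$. A twisted class functional on $\mathcal A_1$ is a linear functional $\gamma:\mathcal A_1\to\mathbb C$ with $\gamma(ax)=\gamma(xa)$ for all $a\in\mathcal A_0$, $x\in\mathcal A_1$. For a left $\mathcal A_0$-module $M$, grade $\mathcal A\otimes_{\mathcal A_0}M$ by letting its $r$-component be the image of $\mathcal A_r\otimes M$, and let $\mathcal A\,\overline\otimes\,M$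 be the quotient of $\mathcal A\otimes_{\mathcal A_0}M$ by its largest graded $\mathcal A$-submodule whose degree-$0$ component is zero. Let $M^{(r)}$ be the $r$-component of $\mathcal A\,\overline\otimes\,M$, an $\mathcal A_0$-module. Let $\mathrm{Sim}(\mathcal A_0)$ be the set of isomorphism classes of simple left $\mathcal A_0$-modules and $\mathrm{Sim}(\mathcal A_0)^{\mathbb Z/m\mathbb Z}$ the subset of the classes of those $M$ with $M^{(r)}\cong M$ as $\mathcal A_0$-modules for all $r\in\mathbb Z/m\mathbb Z$. Then $\mathrm{Sim}(\mathcal A_0)^{\mathbb Z/m\mathbb Z}$ is finite, and the dimension over $\mathbb C$ of the space of twisted class functionals on $\mathcal A_1$ equals the cardinality of $\mathrm{Sim}(\mathcal A_0)^{\mathbb Z/m\mathbb Z}$. -/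

import Mathlib

open scoped TensorProduct DirectSum

universe u v

noncomputable section

namespace TwistedClass

section Graded

variable {m : ℕ} {A : Type u} [Ring A] [Algebra ℂ A]
  (𝒜 : ZMod m → Submodule ℂ A) [GradedAlgebra 𝒜]

/-- The degree-zero component `A₀`, as a subalgebra of `A`. -/
abbrev zeroPart : Subalgebra ℂ A := SetLike.GradeZero.subalgebra 𝒜

/-- The projection `A → A₀` along the other homogeneous components. -/
def projZero : A →ₗ[ℂ] zeroPart 𝒜 :=
  (GradedAlgebra.proj 𝒜 0).codRestrict (Subalgebra.toSubmodule (zeroPart 𝒜))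
    (fun a => (DirectSum.decompose 𝒜 a 0).2)

/-- The extension `lam` of a functional `lam₀` on `A₀` to `A` by zero on `A_r`, `r ≠ 0`. -/
def extendByZero (lam₀ : zeroPart 𝒜 →ₗ[ℂ] ℂ) : A →ₗ[ℂ] ℂ := lam₀ ∘ₗ projZero 𝒜

/-- `(A, lam₀, star)` is a `ℤ/m`-graded Frobenius star-algebra. That `A` is an associative unital
finite-dimensional graded algebra and that `star` is a conjugate-linear involutive
anti-automorphism is expressed by the type classes `Ring`, `Algebra ℂ`, `FiniteDimensional ℂ`,
`GradedAlgebra`, `StarRing`, `StarModule ℂ`; the remaining axioms are listed here. -/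
structure IsGradedFrobeniusStar [StarRing A] [StarModule ℂ A] [FiniteDimensional ℂ A]
    (lam₀ : zeroPart 𝒜 →ₗ[ℂ] ℂ) : Prop where
  /-- `lam₀` is a class functional on `A₀`. -/
  class_functional : ∀ a b : zeroPart 𝒜, lam₀ (a * b) = lam₀ (b * a)
  /-- `(A_r)^* ⊆ A_{-r}`. -/
  star_mem : ∀ (r : ZMod m) (a : A), a ∈ 𝒜 r → star a ∈ 𝒜 (-r)
  /-- The form `⟨a, b⟩ = lam (a b^*)` is Hermitian. -/
  hermitian : ∀ a b : A, extendByZero 𝒜 lam₀ (a * star b) =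
    starRingEnd ℂ (extendByZero 𝒜 lam₀ (b * star a))
  /-- The form `⟨a, b⟩ = lam (a b^*)` is positive definite. -/
  pos_def : ∀ a : A, a ≠ 0 → 0 < (extendByZero 𝒜 lam₀ (a * star a)).re

lemma zeroPart_mul_mem {r : ZMod m} (a : zeroPart 𝒜) (x : 𝒜 r) : (a : A) * (x : A) ∈ 𝒜 r := by
  simpa using SetLike.mul_mem_graded (A := 𝒜) a.2 x.2

lemma mul_zeroPart_mem {r : ZMod m} (x : 𝒜 r) (a : zeroPart 𝒜) : (x : A) * (a : A) ∈ 𝒜 r := by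
  simpa using SetLike.mul_mem_graded (A := 𝒜) x.2 a.2

/-- The space of twisted class functionals on the `A₀`-bimodule `A_r`: linear functionals `γ` on
`A_r` with `γ (a x) = γ (x a)` for all `a ∈ A₀` and `x ∈ A_r`. -/
def twistedClassFunctionals (r : ZMod m) : Submodule ℂ (Module.Dual ℂ (𝒜 r)) where
  carrier := {γ | ∀ (a : zeroPart 𝒜) (x : 𝒜 r),
    γ ⟨(a : A) * (x : A), zeroPart_mul_mem 𝒜 a x⟩ = γ ⟨(x : A) * (a : A), mul_zeroPart_mem 𝒜 x a⟩}
  add_mem' := by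
    intro γ δ hγ hδ a x
    simp only [LinearMap.add_apply]
    rw [hγ a x, hδ a x]
  zero_mem' := by
    intro a x
    rfl
  smul_mem' := by
    intro c γ hγ a x
    simp only [LinearMap.smul_apply]
    rw [hγ a x]

variable (M : Type v) [AddCommGroup M] [Module (zeroPart 𝒜) M]

/-- The relations `(a b) ⊗ x = a ⊗ (b x)`, `b ∈ A₀`, that cut `A ⊗_{A₀} M` out of `A ⊗_ℤ M`. -/
def balancingRelations : Submodule A (A ⊗[ℤ] M) :=
  Submodule.span A {t | ∃ (a : A) (b : zeroPart 𝒜) (x : M),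
    t = (a * (b : A)) ⊗ₜ[ℤ] x - a ⊗ₜ[ℤ] (b • x)}

/-- The left `A`-module `A ⊗_{A₀} M` (over the not necessarily commutative ring `A₀`). -/
abbrev TensorInd : Type (max u v) := (A ⊗[ℤ] M) ⧸ balancingRelations 𝒜 M

/-- The homogeneous component `(A ⊗_{A₀} M)_r`, the image of `A_r ⊗ M`. -/
def tensorComponent (r : ZMod m) : Submodule (zeroPart 𝒜) (TensorInd 𝒜 M) :=
  Submodule.span (zeroPart 𝒜) {t | ∃ (a : 𝒜 r) (x : M),
    t = (balancingRelations 𝒜 M).mkQ ((a : A) ⊗ₜ[ℤ] x)}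

/-- An `A`-submodule `U` of `A ⊗_{A₀} M` is graded if it is the sum of the `U ∩ (A ⊗_{A₀} M)_r`. -/
def IsGradedSubmodule (U : Submodule A (TensorInd 𝒜 M)) : Prop :=
  U.restrictScalars (zeroPart 𝒜) =
    ⨆ r : ZMod m, U.restrictScalars (zeroPart 𝒜) ⊓ tensorComponent 𝒜 M r

/-- A submodule is null if its degree-zero part vanishes. -/
def IsNull (U : Submodule A (TensorInd 𝒜 M)) : Prop :=
  U.restrictScalars (zeroPart 𝒜) ⊓ tensorComponent 𝒜 M 0 = ⊥

/-- The null socle: the largest null graded submodule, that is, the sum of all of them. -/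
def nullSocle : Submodule A (TensorInd 𝒜 M) :=
  sSup {U | IsGradedSubmodule 𝒜 M U ∧ IsNull 𝒜 M U}

/-- The induced module: the quotient of `A ⊗_{A₀} M` by its null socle. -/
abbrev Induced : Type (max u v) := TensorInd 𝒜 M ⧸ nullSocle 𝒜 M

/-- The partial action of `ℤ/m` on simple `A₀`-modules: `M^r` is the `r`-component of the
induced module (it may be zero). -/
def conjugate (r : ZMod m) : Submodule (zeroPart 𝒜) (Induced 𝒜 M) :=
  (tensorComponent 𝒜 M r).map ((nullSocle 𝒜 M).mkQ.restrictScalars (zeroPart 𝒜))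

/-- `M` is `ℤ/m`-invariant: `M^r ≅ M` as `A₀`-modules for all `r ∈ ℤ/m`. -/
def IsInvariant : Prop :=
  ∀ r : ZMod m, Nonempty (conjugate 𝒜 M r ≃ₗ[zeroPart 𝒜] M)

end Graded

section Sim

variable (R : Type u) [Ring R]

/-- Simple left `R`-modules, up to isomorphism as a relation. Every simple `R`-module is a quotient
of `R`, so the universe of `R` contains a copy of each of them. -/
instance simpleSetoid : Setoid {M : ModuleCat.{u} R // IsSimpleModule R M} where
  r M N := Nonempty (M.1 ≃ₗ[R] N.1)
  iseqv :=
    { refl := fun M => ⟨LinearEquiv.refl R M.1⟩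
      symm := fun ⟨e⟩ => ⟨e.symm⟩
      trans := fun ⟨e⟩ ⟨f⟩ => ⟨e.trans f⟩ }

/-- `Sim R`: the set of isomorphism classes of simple left `R`-modules. -/
def Sim : Type (u + 1) := Quotient (simpleSetoid R)

end Sim

/-- `Sim(A₀)^{ℤ/m}`: the set of classes in `Sim(A₀)` of `ℤ/m`-invariant simple modules. -/
def invariantSim {m : ℕ} {A : Type u} [Ring A] [Algebra ℂ A]
    (𝒜 : ZMod m → Submodule ℂ A) [GradedAlgebra 𝒜] : Set (Sim (zeroPart 𝒜)) :=
  {c | ∃ M : {M : ModuleCat.{u} (zeroPart 𝒜) // IsSimpleModule (zeroPart 𝒜) M},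
    Quotient.mk (simpleSetoid (zeroPart 𝒜)) M = c ∧ IsInvariant 𝒜 M.1}

end TwistedClass

end

/-! Positivity makes `A₀` semisimple (`isSemisimpleRing`), hence a product of matrix algebras over
ℂ; its blocks, with identities `e_i`, correspond to the simple modules. Both sides of the equality
count the blocks with `e_i Z ≠ 0`, where `Z` is the centralizer of `A₀` in `A_{-1}`.

Functionals: the pairing `(x, w) ↦ lam (x w)` of `A_1` with `A_{-1}` is perfect by positivity, and
the trace property of `lam₀` identifies the twisted class functionals with `Z`. For `w ∈ Z` the
element `w w^*` is central in `A₀`, so a scalar on each block, nonzero if `e_i w ≠ 0`. Thus `w^*`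
is, up to a scalar, an inverse of `w` on the block (`exists_star_mul_eq`), which forces `dim e_i Z ≤
1`.

Modules: let `M` be the simple module of block `i`. If `u ∈ A_1` inverts some `w ∈ Z` on the block,
then `x ↦ u^r ⊗ x` identifies `M` with `M^r` (`isInvariant_of_gradedCentralizer`). Conversely,
`M^{-1} ≅ M` forces `e_i A_{-1} e_i ≠ 0`, and averaging over matrix units produces `w ∈ Z` with `e_i
w ≠ 0` (`exists_gradedCentralizer_idem_mul_ne_zero`). -/

noncomputable section

namespace TwistedClass

/-! ### Matrix units of a split semisimple algebra -/

section MatrixUnits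

/-- A full system of matrix units of an `F`-algebra `R` that is a product of the matrix algebras
of sizes `d i`. -/
structure MatrixUnits (F R : Type*) [CommSemiring F] [Ring R] [Algebra F R] {ι : Type*} [Fintype ι]
    (d : ι → ℕ) where
  /-- The matrix unit in row `a` and column `b` of the block `i`. -/
  unit : ∀ i, Fin (d i) → Fin (d i) → R
  mul_same : ∀ i a b c, unit i a b * unit i b c = unit i a c
  mul_ne : ∀ i a b c e, b ≠ c → unit i a b * unit i c e = 0
  mul_block_ne : ∀ i j, i ≠ j → ∀ a b c e, unit i a b * unit j c e = 0
  sum_diag : ∑ i, ∑ a, unit i a a = 1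
  mem_span : ∀ r : R, r ∈ Submodule.span F {t | ∃ i a b, t = unit i a b}
  ne_zero : ∀ i a b, unit i a b ≠ 0

theorem exists_matrixUnits (F R : Type*) [Field F] [IsAlgClosed F] [Ring R] [Algebra F R]
    [FiniteDimensional F R] [IsSemisimpleRing R] :
    ∃ (n : ℕ) (d : Fin n → ℕ), (∀ i, NeZero (d i)) ∧ Nonempty (MatrixUnits F R d) := by
  obtain ⟨n, d, hd, ⟨f⟩⟩ := IsSemisimpleRing.exists_algEquiv_pi_matrix_of_isAlgClosed F R
  refine ⟨n, d, hd, ⟨⟨fun i a b => f.symm (Pi.single i (Matrix.single a b 1)), ?_, ?_, ?_, ?_, ?_,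
    ?_⟩⟩⟩
  · intro i a b c
    rw [← map_mul, ← Pi.single_mul, Matrix.single_mul_single_same, one_mul]
  · intro i a b c e h
    rw [← map_mul, ← Pi.single_mul, Matrix.single_mul_single_of_ne _ _ _ _ h, Pi.single_zero,
      map_zero]
  · intro i j h a b c e
    rw [← map_mul]
    convert map_zero f.symm
    ext k : 1
    by_cases hk : k = i
    · subst hk; simp [Pi.single_eq_of_ne h]
    · simp [Pi.single_eq_of_ne hk]
  · simp_rw [← map_sum]
    rw [← map_one f.symm]
    congr 1
    ext k : 1
    rw [Finset.sum_apply, Finset.sum_eq_single k]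
    · simp [Finset.sum_apply, Matrix.sum_single_one]
    · intro j _ hj
      simp [Finset.sum_apply, Pi.single_eq_of_ne hj.symm]
    · simp
  · intro r
    have : r = ∑ i, ∑ a, ∑ b, f r i a b • f.symm (Pi.single i (Matrix.single a b 1)) := by
      apply f.injective
      simp only [map_sum, map_smul, AlgEquiv.apply_symm_apply]
      ext k : 1
      rw [Finset.sum_apply, Finset.sum_eq_single k]
      · conv_lhs => rw [Matrix.matrix_eq_sum_single (f r k)]
        simp [Finset.sum_apply, Matrix.smul_single]
      · intro j _ hj
        simp [Finset.sum_apply, Pi.single_eq_of_ne hj.symm]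
      · simp
    rw [this]
    exact Submodule.sum_mem _ fun i _ => Submodule.sum_mem _ fun a _ => Submodule.sum_mem _
      fun b _ => Submodule.smul_mem _ _ (Submodule.subset_span ⟨i, a, b, rfl⟩)
  · intro i a b h
    rw [map_eq_zero_iff _ f.symm.injective, Pi.single_eq_zero_iff] at h
    simpa using congrFun (congrFun h a) b

namespace MatrixUnits

variable {F R : Type*} [Field F] [Ring R] [Algebra F R] {ι : Type*} [Fintype ι]
  {d : ι → ℕ} (E : MatrixUnits F R d)

/-- The identity of the block `i`. -/
def idem (i : ι) : R := ∑ a, E.unit i a a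

lemma sum_idem : ∑ i, E.idem i = 1 := E.sum_diag

lemma idem_mul_unit (i : ι) (a b : Fin (d i)) : E.idem i * E.unit i a b = E.unit i a b := by
  rw [idem, Finset.sum_mul, Finset.sum_eq_single a, E.mul_same]
  · intro c _ hc
    exact E.mul_ne _ _ _ _ _ hc
  · simp

lemma unit_mul_idem (i : ι) (a b : Fin (d i)) : E.unit i a b * E.idem i = E.unit i a b := by
  rw [idem, Finset.mul_sum, Finset.sum_eq_single b, E.mul_same]
  · intro c _ hc
    exact E.mul_ne _ _ _ _ _ hc.symm
  · simp

lemma idem_mul_unit_of_ne {i j : ι} (h : j ≠ i) (a b : Fin (d i)) :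
    E.idem j * E.unit i a b = 0 := by
  rw [idem, Finset.sum_mul]
  exact Finset.sum_eq_zero fun c _ => E.mul_block_ne _ _ h _ _ _ _

lemma unit_mul_idem_of_ne {i j : ι} (h : j ≠ i) (a b : Fin (d i)) :
    E.unit i a b * E.idem j = 0 := by
  rw [idem, Finset.mul_sum]
  exact Finset.sum_eq_zero fun c _ => E.mul_block_ne _ _ h.symm _ _ _ _

lemma idem_mul_idem (i : ι) : E.idem i * E.idem i = E.idem i := by
  conv_lhs => enter [1]; rw [idem]
  rw [Finset.sum_mul]
  exact Finset.sum_congr rfl fun a _ => E.unit_mul_idem i a a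

lemma idem_mul_idem_of_ne {i j : ι} (h : i ≠ j) : E.idem i * E.idem j = 0 := by
  conv_lhs => rw [idem, Finset.sum_mul]
  exact Finset.sum_eq_zero fun a _ => E.unit_mul_idem_of_ne h.symm a a

/-- Two linear maps that agree on the matrix units are equal. -/
lemma linear_ext {V : Type*} [AddCommGroup V] [Module F V] {f g : R →ₗ[F] V}
    (h : ∀ i a b, f (E.unit i a b) = g (E.unit i a b)) (r : R) : f r = g r := by
  have : Set.EqOn f g {t | ∃ i a b, t = E.unit i a b} := by
    rintro _ ⟨i, a, b, rfl⟩
    exact h i a b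
  exact LinearMap.eqOn_span this (E.mem_span r)

lemma idem_comm (i : ι) (r : R) : E.idem i * r = r * E.idem i := by
  refine E.linear_ext (f := LinearMap.mulLeft F (E.idem i)) (g := LinearMap.mulRight F (E.idem i))
    (fun j a b => ?_) r
  simp only [LinearMap.mulLeft_apply, LinearMap.mulRight_apply]
  by_cases h : i = j
  · subst h
    rw [idem_mul_unit, unit_mul_idem]
  · rw [E.idem_mul_unit_of_ne h, E.unit_mul_idem_of_ne h]

/-- By linearity it suffices to take `r` a matrix unit, where the product is zero or a single matrix
unit. This is the source of every scalar below. -/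
lemma exists_smul_unit (i : ι) (a b c e : Fin (d i)) (r : R) :
    ∃ k : F, E.unit i a b * r * E.unit i c e = k • E.unit i a e := by
  refine Submodule.span_induction (p := fun r _ => ∃ k : F, E.unit i a b * r * E.unit i c e =
    k • E.unit i a e) ?_ ?_ ?_ ?_ (E.mem_span r)
  · rintro _ ⟨j, p, q, rfl⟩
    by_cases h : i = j
    · subst h
      by_cases hb : b = p
      · subst hb
        rw [E.mul_same]
        by_cases hq : q = c
        · subst hq
          exact ⟨1, by rw [E.mul_same, one_smul]⟩
        · exact ⟨0, by rw [E.mul_ne _ _ _ _ _ hq, zero_smul]⟩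
      · exact ⟨0, by rw [E.mul_ne _ _ _ _ _ hb, zero_mul, zero_smul]⟩
    · exact ⟨0, by rw [E.mul_block_ne _ _ h, zero_mul, zero_smul]⟩
  · exact ⟨0, by simp⟩
  · rintro x y _ _ ⟨k, hk⟩ ⟨l, hl⟩
    exact ⟨k + l, by rw [mul_add, add_mul, hk, hl, add_smul]⟩
  · rintro t x _ ⟨k, hk⟩
    exact ⟨t * k, by rw [mul_smul_comm, smul_mul_assoc, hk, mul_smul]⟩

/-- A central element is a scalar on each block. -/
lemma exists_idem_mul_eq_smul [∀ i, NeZero (d i)] (i : ι) (z : R) (hz : ∀ r, z * r = r * z) :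
    ∃ k : F, E.idem i * z = k • E.idem i := by
  obtain ⟨k, hk⟩ := E.exists_smul_unit i 0 0 0 0 z
  refine ⟨k, ?_⟩
  rw [idem, Finset.sum_mul, Finset.smul_sum]
  refine Finset.sum_congr rfl fun a _ => ?_
  -- Centrality carries `z` into the corner at `(0, 0)`, so one scalar serves all diagonal
  -- positions.
  calc E.unit i a a * z = E.unit i a 0 * (E.unit i 0 a * z) := by rw [← mul_assoc, E.mul_same]
    _ = E.unit i a 0 * (z * (E.unit i 0 0 * E.unit i 0 a)) := by rw [hz, E.mul_same]
    _ = E.unit i a 0 * (E.unit i 0 0 * z * E.unit i 0 0) * E.unit i 0 a := by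
      rw [← hz]; simp only [← mul_assoc]; rw [mul_assoc _ (E.unit i 0 0) (E.unit i 0 0),
        E.mul_same]
    _ = k • E.unit i a a := by
      rw [hk, mul_smul_comm, smul_mul_assoc, E.mul_same, E.mul_same]

/-! ### Simple modules as columns of the blocks -/

section Modules

variable {M : Type*} [AddCommGroup M] [Module R M]

lemma exists_unit_smul_ne_zero [∀ i, NeZero (d i)] [Nontrivial M] :
    ∃ (i : ι) (x : M), E.unit i 0 0 • x ≠ 0 := by
  obtain ⟨x, hx⟩ := exists_ne (0 : M)
  by_contra! h
  apply hx
  rw [← one_smul R x, ← E.sum_diag, Finset.sum_smul]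
  refine Finset.sum_eq_zero fun i _ => ?_
  rw [Finset.sum_smul]
  refine Finset.sum_eq_zero fun a _ => ?_
  rw [← E.mul_same i a 0 a, ← E.mul_same i a 0 0, mul_smul, mul_smul, ← mul_smul (E.unit i 0 0),
    E.mul_same]
  have := h i (E.unit i 0 a • x)
  rw [← mul_smul, E.mul_same] at this
  rw [this, smul_zero]

/-- On a simple module one of the block identities acts as the identity. -/
lemma idem_smul_eq [∀ i, NeZero (d i)] [IsSimpleModule R M] {i : ι} {x : M}
    (hx : E.unit i 0 0 • x ≠ 0) (y : M) : E.idem i • y = y := by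
  obtain ⟨r, rfl⟩ := IsSimpleModule.toSpanSingleton_surjective R hx y
  rw [LinearMap.toSpanSingleton_apply, ← mul_smul, ← mul_smul, E.idem_comm, mul_assoc,
    E.idem_mul_unit, mul_smul]

/-- The simple left ideal spanned by a column of the block `i`. -/
def column [∀ i, NeZero (d i)] (i : ι) : Submodule R R := Submodule.span R {E.unit i 0 0}

variable [∀ i, NeZero (d i)]

lemma mem_column {i : ι} {x : R} : x ∈ E.column i ↔ x * E.unit i 0 0 = x := by
  rw [column, Submodule.mem_span_singleton]
  constructor
  · rintro ⟨r, rfl⟩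
    rw [smul_eq_mul, mul_assoc, E.mul_same]
  · intro h
    exact ⟨x, h⟩

instance isSimpleModule_column (i : ι) : IsSimpleModule R (E.column i) := by
  rw [isSimpleModule_iff_toSpanSingleton_surjective]
  have h0 : E.unit i 0 0 ∈ E.column i := E.mem_column.2 (E.mul_same _ _ _ _)
  refine ⟨⟨⟨⟨_, h0⟩, 0, fun h => E.ne_zero i 0 0 (congrArg Subtype.val h)⟩⟩, ?_⟩
  rintro ⟨x, hx⟩ hx0 ⟨y, hy⟩
  have hx0 : x ≠ 0 := fun h => hx0 (Subtype.ext h)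
  rw [mem_column] at hx hy
  -- A nonzero column has a nonzero entry `k` in some row `a`; `k⁻¹ y E_{0a}` then sends `x` to `y`.
  obtain ⟨a, ha⟩ : ∃ a, E.unit i a a * x ≠ 0 := by
    by_contra! h
    apply hx0
    rw [← hx, ← E.idem_mul_unit, ← mul_assoc, ← E.idem_comm, idem, Finset.sum_mul, Finset.sum_mul]
    exact Finset.sum_eq_zero fun a _ => by rw [h, zero_mul]
  obtain ⟨k, hk⟩ := E.exists_smul_unit i a a 0 0 x
  rw [mul_assoc, hx] at hk
  have hk0 : k ≠ 0 := by
    rintro rfl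
    exact ha (by rw [hk, zero_smul])
  refine ⟨k⁻¹ • (y * E.unit i 0 a), Subtype.ext ?_⟩
  change k⁻¹ • (y * E.unit i 0 a) * x = y
  rw [smul_mul_assoc, mul_assoc, ← E.mul_same i 0 a a, mul_assoc, hk, mul_smul_comm, mul_smul_comm,
    smul_smul, inv_mul_cancel₀ hk0, one_smul, E.mul_same, hy]

/-- A simple module on which the block `i` acts non-trivially is isomorphic to the column of that
block. -/
lemma nonempty_equiv_column [IsSimpleModule R M] {i : ι} {x : M} (hx : E.unit i 0 0 • x ≠ 0) :
    Nonempty (E.column i ≃ₗ[R] M) := by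
  let f : E.column i →ₗ[R] M := (LinearMap.toSpanSingleton R M x).domRestrict (E.column i)
  have hf : f ≠ 0 := by
    intro h
    exact hx (LinearMap.congr_fun h ⟨_, E.mem_column.2 (E.mul_same _ _ _ _)⟩)
  exact ⟨LinearEquiv.ofBijective f (LinearMap.bijective_of_ne_zero hf)⟩

lemma unit_smul_column_ne_zero (i : ι) :
    E.unit i 0 0 • (⟨E.unit i 0 0, E.mem_column.2 (E.mul_same _ _ _ _)⟩ : E.column i) ≠ 0 := by
  intro h
  have := congrArg Subtype.val h
  change E.unit i 0 0 * E.unit i 0 0 = 0 at this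
  rw [E.mul_same] at this
  exact E.ne_zero _ _ _ this

/-- The central idempotent of block `j` is the identity on its own column but kills the generator of
any other. -/
lemma eq_of_column_equiv {i j : ι} (f : E.column i ≃ₗ[R] E.column j) : i = j := by
  by_contra h
  set v : E.column i := ⟨E.unit i 0 0, E.mem_column.2 (E.mul_same _ _ _ _)⟩
  have hv := E.unit_smul_column_ne_zero i
  have h1 := E.idem_smul_eq (E.unit_smul_column_ne_zero j) (f (E.unit i 0 0 • v))
  rw [← map_smul, ← mul_smul, E.idem_mul_unit_of_ne (Ne.symm h), zero_smul, map_zero] at h1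
  exact hv ((map_eq_zero_iff f f.injective).1 h1.symm)

end Modules

end MatrixUnits

end MatrixUnits

/-! ### Semisimplicity, and twisted class functionals as centralizing elements -/

section Frobenius

variable {m : ℕ} {A : Type u} [Ring A] [Algebra ℂ A] (𝒜 : ZMod m → Submodule ℂ A)
  [GradedAlgebra 𝒜]

lemma extendByZero_coe (lam₀ : zeroPart 𝒜 →ₗ[ℂ] ℂ) (a : zeroPart 𝒜) :
    extendByZero 𝒜 lam₀ (a : A) = lam₀ a := by
  rw [extendByZero, LinearMap.comp_apply]
  congr 1
  exact Subtype.ext (DirectSum.decompose_of_mem_same 𝒜 a.2)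

lemma mul_mem_zero {r : ZMod m} {a b : A} (ha : a ∈ 𝒜 r) (hb : b ∈ 𝒜 (-r)) : a * b ∈ 𝒜 0 := by
  simpa using SetLike.mul_mem_graded ha hb

/-- The elements of degree `r` that commute with `A₀`. -/
def gradedCentralizer (r : ZMod m) : Submodule ℂ A where
  carrier := {w | w ∈ 𝒜 r ∧ ∀ a ∈ 𝒜 0, a * w = w * a}
  add_mem' := by
    rintro x y ⟨hx, hx'⟩ ⟨hy, hy'⟩
    exact ⟨add_mem hx hy, fun a ha => by rw [mul_add, add_mul, hx' a ha, hy' a ha]⟩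
  zero_mem' := ⟨zero_mem _, fun a _ => by simp⟩
  smul_mem' := by
    rintro c x ⟨hx, hx'⟩
    exact ⟨Submodule.smul_mem _ c hx, fun a ha => by
      rw [mul_smul_comm, smul_mul_assoc, hx' a ha]⟩

variable {𝒜}

lemma gradedCentralizer.pow_mem {r : ZMod m} {w : A} (hw : w ∈ gradedCentralizer 𝒜 r) (k : ℕ) :
    w ^ k ∈ gradedCentralizer 𝒜 (k * r) := by
  refine ⟨by simpa using SetLike.pow_mem_graded k hw.1, fun a ha => ?_⟩
  exact (Commute.pow_right (show Commute a w from hw.2 a ha) k).eq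

variable [FiniteDimensional ℂ A] [StarRing A] [StarModule ℂ A] {lam₀ : zeroPart 𝒜 →ₗ[ℂ] ℂ}
  (hA : IsGradedFrobeniusStar 𝒜 lam₀)

include hA

namespace IsGradedFrobeniusStar

lemma star_mem_zero {a : A} (ha : a ∈ 𝒜 0) : star a ∈ 𝒜 0 := by
  simpa using hA.star_mem 0 a ha

lemma star_mem_of_neg {r : ZMod m} {a : A} (ha : a ∈ 𝒜 (-r)) : star a ∈ 𝒜 r := by
  simpa using hA.star_mem (-r) a ha

lemma extendByZero_mul_comm {a b : A} (ha : a ∈ 𝒜 0) (hb : b ∈ 𝒜 0) :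
    extendByZero 𝒜 lam₀ (a * b) = extendByZero 𝒜 lam₀ (b * a) := by
  have h := hA.class_functional ⟨a, ha⟩ ⟨b, hb⟩
  rwa [← extendByZero_coe, ← extendByZero_coe] at h

lemma eq_zero_of_extendByZero {a : A} (h : extendByZero 𝒜 lam₀ (a * star a) = 0) : a = 0 := by
  by_contra h0
  have := hA.pos_def a h0
  rw [h] at this
  exact lt_irrefl _ this

lemma mul_star_ne_zero {a : A} (h : a ≠ 0) : a * star a ≠ 0 := fun h0 =>
  h (hA.eq_zero_of_extendByZero (by rw [h0, map_zero]))

/-- The degree-zero part is semisimple: orthogonal complements of left ideals are left ideals. -/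
lemma isSemisimpleRing : IsSemisimpleRing (zeroPart 𝒜) := by
  have key : ∀ I : Submodule (zeroPart 𝒜) (zeroPart 𝒜), ∃ J, IsCompl I J := by
    intro I
    let S : Submodule ℂ (zeroPart 𝒜) := I.restrictScalars ℂ
    let st : zeroPart 𝒜 → zeroPart 𝒜 := fun a => ⟨star (a : A), hA.star_mem_zero a.2⟩
    let J : Submodule (zeroPart 𝒜) (zeroPart 𝒜) :=
      { carrier := {b | ∀ a ∈ I, lam₀ (b * st a) = 0}
        add_mem' := fun {x y} hx hy a ha => by rw [add_mul, map_add, hx a ha, hy a ha, add_zero]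
        zero_mem' := fun a _ => by rw [zero_mul, map_zero]
        smul_mem' := fun c x hx a ha => by
          -- The trace property moves `c` to the right of `a^*`, where it is absorbed as `(c^* a)^*`
          -- with `c^* a ∈ I`.
          have h1 : st (st c * a) = st a * c := Subtype.ext (by simp [st])
          have h2 := hx (st c * a) (I.smul_mem _ ha)
          rw [h1] at h2
          rw [smul_eq_mul, mul_assoc, hA.class_functional, mul_assoc, h2] }
    have hJ : ∀ b, b ∈ J ↔ ∀ a ∈ I, lam₀ (b * st a) = 0 := fun b => Iff.rfl
    have hdisj : I ⊓ J = ⊥ := by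
      rw [eq_bot_iff]
      rintro x ⟨hx, hx'⟩
      have h := hx' x hx
      rw [← extendByZero_coe] at h
      exact Subtype.ext (hA.eq_zero_of_extendByZero h)
    refine ⟨J, disjoint_iff.2 hdisj, codisjoint_iff.2 ?_⟩
    let T : Submodule ℂ (zeroPart 𝒜) := J.restrictScalars ℂ
    -- `T` is the common kernel of `dim S` functionals
    let bS := Module.finBasis ℂ S
    let φ : zeroPart 𝒜 →ₗ[ℂ] (Fin (Module.finrank ℂ S) → ℂ) :=
      LinearMap.pi fun i => lam₀ ∘ₗ LinearMap.mulRight ℂ (st (bS i))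
    have hker : LinearMap.ker φ ≤ T := by
      intro b hb a ha
      have hb' : ∀ i, lam₀ (b * st (bS i)) = 0 := fun i => congrFun (LinearMap.mem_ker.1 hb) i
      have hstadd : ∀ x y, st (x + y) = st x + st y := fun x y => Subtype.ext (by simp [st])
      have hstsmul : ∀ (c : ℂ) x, st (c • x) = star c • st x := fun c x =>
        Subtype.ext (by simp [st])
      have hst0 : st 0 = 0 := Subtype.ext (by simp [st])
      have hspan : ∀ s : S, lam₀ (b * st s) = 0 := by
        intro s
        have hs : s ∈ Submodule.span ℂ (Set.range bS) := by rw [bS.span_eq]; trivial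
        induction hs using Submodule.span_induction with
        | mem x hx => obtain ⟨i, rfl⟩ := hx; exact hb' i
        | zero => simp [hst0]
        | add x y _ _ hx hy =>
          rw [Submodule.coe_add, hstadd, mul_add, map_add, hx, hy, add_zero]
        | smul c x _ hx =>
          rw [Submodule.coe_smul, hstsmul, mul_smul_comm, map_smul, hx, smul_zero]
      exact hspan ⟨a, ha⟩
    -- Complementarity follows by counting dimensions, since `S ⊓ T = ⊥`.
    have hrank : Module.finrank ℂ (zeroPart 𝒜) ≤ Module.finrank ℂ S + Module.finrank ℂ T := by
      have h1 := LinearMap.finrank_range_add_finrank_ker φ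
      have h2 := Submodule.finrank_le (LinearMap.range φ)
      have h3 := Submodule.finrank_mono hker
      rw [Module.finrank_fin_fun] at h2
      lia
    have hST : S ⊓ T = ⊥ := by
      apply SetLike.coe_injective
      exact congrArg (fun U : Submodule (zeroPart 𝒜) (zeroPart 𝒜) => (U : Set (zeroPart 𝒜))) hdisj
    have htop : S ⊔ T = ⊤ := by
      apply Submodule.eq_top_of_finrank_eq
      have h1 := Submodule.finrank_sup_add_finrank_inf_eq S T
      have h2 := Submodule.finrank_le (S ⊔ T)
      rw [hST, finrank_bot] at h1
      lia
    rw [eq_top_iff]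
    rintro x -
    obtain ⟨y, hy, z, hz, rfl⟩ := Submodule.mem_sup.1 (htop ▸ Submodule.mem_top : x ∈ S ⊔ T)
    exact Submodule.add_mem_sup hy hz
  exact (isSemisimpleModule_iff _ _).2 ⟨key⟩

lemma star_mem_gradedCentralizer {r : ZMod m} {w : A} (hw : w ∈ gradedCentralizer 𝒜 r) :
    star w ∈ gradedCentralizer 𝒜 (-r) := by
  refine ⟨hA.star_mem _ _ hw.1, fun a ha => ?_⟩
  have := congrArg star (hw.2 (star a) (hA.star_mem_zero ha))
  simpa using this.symm

variable (lam₀) in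
omit hA [FiniteDimensional ℂ A] [StarRing A] [StarModule ℂ A] in
/-- The pairing `(x, w) ↦ lam (x w)` between the components of degrees `r` and `-r`. -/
def pairing (r : ZMod m) : 𝒜 r →ₗ[ℂ] 𝒜 (-r) →ₗ[ℂ] ℂ :=
  ((LinearMap.mul ℂ A).compr₂ (extendByZero 𝒜 lam₀)).domRestrict₁₂ (𝒜 r) (𝒜 (-r))

omit hA [FiniteDimensional ℂ A] [StarRing A] [StarModule ℂ A] in
lemma pairing_apply {r : ZMod m} (x : 𝒜 r) (w : 𝒜 (-r)) :
    pairing lam₀ r x w = extendByZero 𝒜 lam₀ ((x : A) * (w : A)) := rfl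

/-- Definiteness gives nondegeneracy on both sides: test `x` against `x^*` and `w` against `w^*`. -/
lemma isPerfPair_pairing (r : ZMod m) : (pairing lam₀ r).IsPerfPair := by
  apply LinearMap.IsPerfPair.of_injective
  · rw [← LinearMap.ker_eq_bot, eq_bot_iff]
    intro x hx
    have h := LinearMap.congr_fun (LinearMap.mem_ker.1 hx) ⟨star (x : A), hA.star_mem r _ x.2⟩
    rw [pairing_apply] at h
    exact Subtype.ext (hA.eq_zero_of_extendByZero h)
  · rw [← LinearMap.ker_eq_bot, eq_bot_iff]
    intro w hw
    have h := LinearMap.congr_fun (LinearMap.mem_ker.1 hw)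
      ⟨star (w : A), hA.star_mem_of_neg w.2⟩
    rw [LinearMap.flip_apply, pairing_apply] at h
    refine Subtype.ext (star_eq_zero.1 (hA.eq_zero_of_extendByZero (a := star (w : A)) ?_))
    rw [star_star]
    exact h

/-- An element `w` of degree `-r` represents a twisted class functional if and only if it commutes
with `A₀`. -/
lemma flip_pairing_mem_iff {r : ZMod m} (w : 𝒜 (-r)) :
    (pairing lam₀ r).flip w ∈ twistedClassFunctionals 𝒜 r ↔
      (w : A) ∈ gradedCentralizer 𝒜 (-r) := by
  -- Only `lam₀` is assumed to be a trace, so the commutation is applied to `a` and `x w`, both of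
  -- degree zero.
  have hl : ∀ (a : zeroPart 𝒜) (x : 𝒜 r),
      (pairing lam₀ r).flip w ⟨(a : A) * (x : A), zeroPart_mul_mem 𝒜 a x⟩ =
        extendByZero 𝒜 lam₀ ((x : A) * ((w : A) * (a : A))) := by
    intro a x
    rw [LinearMap.flip_apply, pairing_apply, mul_assoc,
      hA.extendByZero_mul_comm a.2 (mul_mem_zero 𝒜 x.2 w.2), mul_assoc]
  have hr : ∀ (a : zeroPart 𝒜) (x : 𝒜 r),
      (pairing lam₀ r).flip w ⟨(x : A) * (a : A), mul_zeroPart_mem 𝒜 x a⟩ =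
        extendByZero 𝒜 lam₀ ((x : A) * ((a : A) * (w : A))) := by
    intro a x
    rw [LinearMap.flip_apply, pairing_apply, mul_assoc]
  constructor
  · intro h
    refine ⟨w.2, fun a ha => ?_⟩
    have key : (pairing lam₀ r).flip ⟨a * (w : A), zeroPart_mul_mem 𝒜 ⟨a, ha⟩ w⟩ =
        (pairing lam₀ r).flip ⟨(w : A) * a, mul_zeroPart_mem 𝒜 w ⟨a, ha⟩⟩ := by
      ext x
      have := h ⟨a, ha⟩ x
      rw [hl, hr] at this
      exact this.symm
    exact congrArg Subtype.val ((hA.isPerfPair_pairing r).bijective_right.injective key)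
  · intro h a x
    rw [hl, hr, h.2 a a.2]

lemma finrank_twistedClassFunctionals (r : ZMod m) :
    Module.finrank ℂ (twistedClassFunctionals 𝒜 r) =
      Module.finrank ℂ (gradedCentralizer 𝒜 (-r)) := by
  let f : 𝒜 (-r) ≃ₗ[ℂ] Module.Dual ℂ (𝒜 r) :=
    LinearEquiv.ofBijective _ (hA.isPerfPair_pairing r).bijective_right
  have h1 : (twistedClassFunctionals 𝒜 r).comap f.toLinearMap =
      (gradedCentralizer 𝒜 (-r)).comap (𝒜 (-r)).subtype := by
    ext w
    exact hA.flip_pairing_mem_iff w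
  have h2 : gradedCentralizer 𝒜 (-r) ≤ 𝒜 (-r) := fun w hw => hw.1
  rw [← (Submodule.comapSubtypeEquivOfLe h2).finrank_eq, ← h1,
    (Submodule.comap_equiv_eq_map_symm f (twistedClassFunctionals 𝒜 r) :)]
  exact (LinearEquiv.finrank_map_eq f.symm _).symm

/-! ### The centralizer of `A₀`, block by block -/

section Blocks

variable {n : ℕ} {d : Fin n → ℕ} [∀ i, NeZero (d i)] (E : MatrixUnits ℂ (zeroPart 𝒜) d)

omit hA [FiniteDimensional ℂ A] [StarRing A] [StarModule ℂ A] in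
-- The product `z w` has degree zero and commutes with `A₀`, so it is central there.
lemma exists_idem_mul_mul {r : ZMod m} {z w : A} (hz : z ∈ gradedCentralizer 𝒜 r)
    (hw : w ∈ gradedCentralizer 𝒜 (-r)) (i : Fin n) :
    ∃ c : ℂ, (E.idem i : A) * (z * w) = c • (E.idem i : A) := by
  obtain ⟨c, hc⟩ := E.exists_idem_mul_eq_smul i ⟨z * w, mul_mem_zero 𝒜 hz.1 hw.1⟩ (by
    rintro ⟨a, ha⟩
    refine Subtype.ext ?_
    change z * w * a = a * (z * w)
    rw [mul_assoc, ← hw.2 a ha, ← mul_assoc, ← hz.2 a ha, mul_assoc])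
  exact ⟨c, congrArg Subtype.val hc⟩

/-- A rescaled `w^*` inverts `w` on the block; positivity is what makes the scalar invertible. -/
lemma exists_star_mul_eq {r : ZMod m} {w : A} (hw : w ∈ gradedCentralizer 𝒜 r) {i : Fin n}
    (hi : (E.idem i : A) * w ≠ 0) : ∃ u ∈ gradedCentralizer 𝒜 (-r),
      (E.idem i : A) * (w * u) = E.idem i ∧ (E.idem i : A) * (u * w) = E.idem i := by
  set e : A := ↑(E.idem i) with he
  have hwe : e * w = w * e := hw.2 _ (E.idem i).2
  have hsw := hA.star_mem_gradedCentralizer hw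
  have hse : e * star w = star w * e := hsw.2 _ (E.idem i).2
  have hee : e * e = e := congrArg Subtype.val (E.idem_mul_idem i)
  obtain ⟨c, hc⟩ := exists_idem_mul_mul E hw hsw i
  obtain ⟨c', hc'⟩ := exists_idem_mul_mul E hsw (by rwa [neg_neg]) i
  rw [← he] at hc hc'
  -- If `c = 0`, then `(e w)(e w)^* = 0`, contradicting definiteness.
  have hc0 : c ≠ 0 := by
    rintro rfl
    apply hA.mul_star_ne_zero hi
    rw [star_mul, mul_assoc, ← mul_assoc w, ← mul_assoc, hc, zero_smul, zero_mul]
  -- Evaluate `e w w^* w` in two ways, so that the same multiple of `w^*` is a two-sided inverse.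
  have hcc : c' = c := by
    have h1 : e * (w * (star w * w)) = c • (e * w) := by
      rw [← mul_assoc w, ← mul_assoc, hc, smul_mul_assoc]
    have h2 : e * (w * (star w * w)) = c' • (e * w) := by
      rw [← mul_assoc, hwe, mul_assoc, hc', mul_smul_comm]
    rw [h2] at h1
    exact smul_left_injective ℂ hi h1
  refine ⟨c⁻¹ • star w, Submodule.smul_mem _ _ hsw, ?_, ?_⟩
  · rw [mul_smul_comm, mul_smul_comm, hc, smul_smul, inv_mul_cancel₀ hc0, one_smul]
  · rw [smul_mul_assoc, mul_smul_comm, hc', hcc, smul_smul, inv_mul_cancel₀ hc0, one_smul]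

/-- The block component of the centralizer of `A₀` is at most one-dimensional. -/
lemma exists_idem_mul_eq_smul {r : ZMod m} {w z : A} (hw : w ∈ gradedCentralizer 𝒜 r)
    (hz : z ∈ gradedCentralizer 𝒜 r) {i : Fin n} (hi : (E.idem i : A) * w ≠ 0) :
    ∃ c : ℂ, (E.idem i : A) * z = c • ((E.idem i : A) * w) := by
  obtain ⟨u, hu, -, huw⟩ := hA.exists_star_mul_eq E hw hi
  obtain ⟨c, hc⟩ := exists_idem_mul_mul E hz hu i
  refine ⟨c, ?_⟩
  calc (E.idem i : A) * z = z * ((E.idem i : A) * (u * w)) := by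
        rw [huw, hz.2 _ (E.idem i).2]
    _ = (E.idem i : A) * (z * u) * w := by
        rw [← mul_assoc, ← hz.2 _ (E.idem i).2]; simp only [mul_assoc]
    _ = _ := by rw [hc, smul_mul_assoc]

/-- Choosing one `w` for each contributing block, the elements `e_i w` form a basis: orthogonality
of the `e_i` gives independence, and `z = ∑ e_i z` with one-dimensional block components gives
spanning. -/
lemma finrank_gradedCentralizer (r : ZMod m) :
    Module.finrank ℂ (gradedCentralizer 𝒜 r) =
      {i | ∃ w ∈ gradedCentralizer 𝒜 r, (E.idem i : A) * w ≠ 0}.ncard := by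
  classical
  set I := {i | ∃ w ∈ gradedCentralizer 𝒜 r, (E.idem i : A) * w ≠ 0}
  have hcoe : ∀ i : I, ∃ w ∈ gradedCentralizer 𝒜 r, (E.idem i : A) * w ≠ 0 := fun i => i.2
  choose w hw hw0 using hcoe
  have hmem : ∀ i : I, (E.idem i : A) * w i ∈ gradedCentralizer 𝒜 r := by
    intro i
    refine ⟨zeroPart_mul_mem 𝒜 _ ⟨w i, (hw i).1⟩, fun a ha => ?_⟩
    have h1 : (E.idem i : A) * a = a * (E.idem i : A) :=
      congrArg Subtype.val (E.idem_comm i ⟨a, ha⟩)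
    rw [← mul_assoc, ← h1, mul_assoc, (hw i).2 a ha, mul_assoc]
  let v : I → gradedCentralizer 𝒜 r := fun i => ⟨_, hmem i⟩
  have hv : LinearIndependent ℂ v := by
    rw [Fintype.linearIndependent_iff]
    intro g hg i
    have h1 : (E.idem i : A) * (∑ j, g j • ((E.idem j : A) * w j)) = 0 := by
      have := congrArg Subtype.val hg
      simp only [Submodule.coe_sum, Submodule.coe_smul, v, Submodule.coe_zero] at this
      rw [this, mul_zero]
    rw [Finset.mul_sum, Finset.sum_eq_single i, mul_smul_comm, ← mul_assoc] at h1
    · have h2 : (E.idem i : A) * (E.idem i : A) = E.idem i :=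
        congrArg Subtype.val (E.idem_mul_idem i)
      rw [h2] at h1
      exact (smul_eq_zero.1 h1).resolve_right (hw0 i)
    · intro j _ hj
      have h2 : (E.idem i : A) * (E.idem j : A) = 0 :=
        congrArg Subtype.val (E.idem_mul_idem_of_ne fun h => hj (Subtype.ext h.symm))
      rw [mul_smul_comm, ← mul_assoc, h2, zero_mul, smul_zero]
    · simp
  have hspan : ⊤ ≤ Submodule.span ℂ (Set.range v) := by
    rintro ⟨z, hz⟩ -
    have hc : ∀ i : I, ∃ c : ℂ, (E.idem i : A) * z = c • ((E.idem i : A) * w i) := fun i =>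
      hA.exists_idem_mul_eq_smul E (hw i) hz (hw0 i)
    choose c hc using hc
    have hsum : (⟨z, hz⟩ : gradedCentralizer 𝒜 r) = ∑ i, c i • v i := by
      apply Subtype.ext
      have h1 : ∑ i, (E.idem i : A) = 1 := by
        have := congrArg Subtype.val E.sum_idem
        simpa using this
      simp only [Submodule.coe_sum, Submodule.coe_smul, v]
      rw [← one_mul z, ← h1, Finset.sum_mul]
      simp_rw [← hc]
      rw [Finset.sum_set_coe I (f := fun i => (E.idem i : A) * z)]
      symm
      apply Finset.sum_subset (Finset.subset_univ _)
      intro i _ hi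
      by_contra h
      exact hi (by simpa using ⟨z, hz, h⟩)
    rw [hsum]
    exact Submodule.sum_mem _ fun i _ => Submodule.smul_mem _ _ (Submodule.subset_span ⟨i, rfl⟩)
  rw [Module.finrank_eq_card_basis (Module.Basis.mk hv hspan), ← Nat.card_eq_fintype_card,
    Nat.card_coe_set_eq]

end Blocks

end IsGradedFrobeniusStar

end Frobenius

/-! ### Detecting nonzero elements of the induced module; conjugates -/

section InducedModule

variable {m : ℕ} {A : Type u} [Ring A] [Algebra ℂ A] (𝒜 : ZMod m → Submodule ℂ A)
  [GradedAlgebra 𝒜] (M : Type v) [AddCommGroup M] [Module (zeroPart 𝒜) M]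

variable {M} in
/-- The class of `a ⊗ x` in `A ⊗_{A₀} M`. -/
def tensorMk (a : A) (x : M) : TensorInd 𝒜 M := (balancingRelations 𝒜 M).mkQ (a ⊗ₜ[ℤ] x)

variable {M} in
/-- The class of `a ⊗ x` in the induced module. -/
def inducedMk (a : A) (x : M) : Induced 𝒜 M := (nullSocle 𝒜 M).mkQ (tensorMk 𝒜 a x)

/-- The additive map `A ⊗ M → M`, `a ⊗ x ↦ a₀ x`. -/
def tensorProj : A ⊗[ℤ] M →+ M :=
  TensorProduct.liftAddHom
    { toFun := fun a => (DistribSMul.toAddMonoidHom M (projZero 𝒜 a))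
      map_zero' := by ext x; simp
      map_add' := fun a b => by ext x; simp [add_smul] }
    (fun n a x => by rw [map_zsmul, map_zsmul]; rfl)

lemma tensorProj_tmul (a : A) (x : M) : tensorProj 𝒜 M (a ⊗ₜ[ℤ] x) = projZero 𝒜 a • x := rfl

lemma projZero_mul_coe (a : A) (b : zeroPart 𝒜) : projZero 𝒜 (a * b) = projZero 𝒜 a * b :=
  Subtype.ext (DirectSum.coe_decompose_mul_of_right_mem_zero 𝒜 b.2)

lemma projZero_coe_mul (b : zeroPart 𝒜) (a : A) : projZero 𝒜 (b * a) = b * projZero 𝒜 a :=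
  Subtype.ext (DirectSum.coe_decompose_mul_of_left_mem_zero 𝒜 b.2)

lemma projZero_eq_zero {r : ZMod m} (hr : r ≠ 0) {a : A} (ha : a ∈ 𝒜 r) : projZero 𝒜 a = 0 :=
  Subtype.ext (DirectSum.decompose_of_mem_ne 𝒜 ha hr)

lemma tensorProj_coe_smul (b : zeroPart 𝒜) (t : A ⊗[ℤ] M) :
    tensorProj 𝒜 M ((b : A) • t) = b • tensorProj 𝒜 M t := by
  induction t using TensorProduct.induction_on with
  | zero => simp
  | tmul a x =>
    rw [TensorProduct.smul_tmul', smul_eq_mul, tensorProj_tmul, tensorProj_tmul, projZero_coe_mul,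
      mul_smul]
  | add s t hs ht => rw [smul_add, map_add, hs, ht, map_add, smul_add]

lemma tensorProj_eq_zero {t : A ⊗[ℤ] M} (ht : t ∈ balancingRelations 𝒜 M) :
    tensorProj 𝒜 M t = 0 := by
  -- The relations span an `A`-submodule while the projection is only `A₀`-linear, so the induction
  -- needs all translates `a • t`.
  have : ∀ a : A, tensorProj 𝒜 M (a • t) = 0 := by
    rw [balancingRelations] at ht
    induction ht using Submodule.span_induction with
    | mem t h =>
      obtain ⟨a, b, x, rfl⟩ := h
      intro c
      rw [smul_sub, TensorProduct.smul_tmul', TensorProduct.smul_tmul', map_sub, tensorProj_tmul,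
        tensorProj_tmul, smul_eq_mul, smul_eq_mul, ← mul_assoc, projZero_mul_coe, mul_smul, sub_self]
    | zero => simp
    | add x y _ _ hx hy => intro c; rw [smul_add, map_add, hx, hy, add_zero]
    | smul a x _ hx => intro c; rw [← mul_smul]; exact hx _
  simpa using this 1

/-- The `A₀`-linear map `A ⊗_{A₀} M → M`, `a ⊗ x ↦ a₀ x`. -/
def tensorIndProj : TensorInd 𝒜 M →ₗ[zeroPart 𝒜] M where
  toFun := QuotientAddGroup.lift (balancingRelations 𝒜 M).toAddSubgroup (tensorProj 𝒜 M)
    (fun _ h => tensorProj_eq_zero 𝒜 M h)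
  map_add' := map_add _
  map_smul' b t := by
    obtain ⟨t, rfl⟩ := Submodule.mkQ_surjective _ t
    exact tensorProj_coe_smul 𝒜 M b t

variable {M}

lemma tensorIndProj_mk (a : A) (x : M) :
    tensorIndProj 𝒜 M (tensorMk 𝒜 a x) = projZero 𝒜 a • x := rfl

lemma tensorMk_mul (a : A) (b : zeroPart 𝒜) (x : M) :
    tensorMk 𝒜 (a * b) x = tensorMk 𝒜 a (b • x) := by
  rw [← sub_eq_zero, tensorMk, tensorMk, ← map_sub]
  exact (Submodule.Quotient.mk_eq_zero _).2 (Submodule.subset_span ⟨a, b, x, rfl⟩)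

lemma smul_tensorMk (a b : A) (x : M) : a • tensorMk 𝒜 b x = tensorMk 𝒜 (a * b) x := rfl

lemma tensorIndProj_eq_zero {r : ZMod m} (hr : r ≠ 0) {t : TensorInd 𝒜 M}
    (ht : t ∈ tensorComponent 𝒜 M r) : tensorIndProj 𝒜 M t = 0 := by
  suffices h : tensorComponent 𝒜 M r ≤ LinearMap.ker (tensorIndProj 𝒜 M) from h ht
  refine Submodule.span_le.2 ?_
  rintro _ ⟨a, x, rfl⟩
  change projZero 𝒜 (a : A) • x = 0
  rw [projZero_eq_zero 𝒜 hr a.2, zero_smul]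

lemma tensorIndProj_eq_zero_of_null {U : Submodule A (TensorInd 𝒜 M)}
    (hU : IsGradedSubmodule 𝒜 M U) (hU0 : IsNull 𝒜 M U) {t : TensorInd 𝒜 M} (ht : t ∈ U) :
    tensorIndProj 𝒜 M t = 0 := by
  suffices h : U.restrictScalars (zeroPart 𝒜) ≤ LinearMap.ker (tensorIndProj 𝒜 M) from h ht
  rw [hU]
  refine iSup_le fun r => ?_
  by_cases hr : r = 0
  · subst hr
    rw [hU0]
    exact bot_le
  · rintro x ⟨-, hx⟩
    exact tensorIndProj_eq_zero 𝒜 hr hx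

lemma tensorIndProj_eq_zero_of_mem_nullSocle {t : TensorInd 𝒜 M} (ht : t ∈ nullSocle 𝒜 M) :
    tensorIndProj 𝒜 M t = 0 := by
  -- `K` is the largest `A`-submodule inside the kernel of the projection to `M`, so it contains
  -- every null graded submodule and hence their sum.
  let K : Submodule A (TensorInd 𝒜 M) :=
    { carrier := {t | ∀ a : A, tensorIndProj 𝒜 M (a • t) = 0}
      add_mem' := fun {x y} hx hy a => by rw [smul_add, map_add, hx, hy, add_zero]
      zero_mem' := fun a => by rw [smul_zero, map_zero]
      smul_mem' := fun c x hx a => by rw [← mul_smul]; exact hx _ }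
  have hK : nullSocle 𝒜 M ≤ K := by
    refine sSup_le ?_
    rintro U ⟨hU, hU0⟩ x hx a
    exact tensorIndProj_eq_zero_of_null 𝒜 hU hU0 (U.smul_mem a hx)
  simpa using hK ht 1

lemma inducedMk_mul (a : A) (b : zeroPart 𝒜) (x : M) :
    inducedMk 𝒜 (a * b) x = inducedMk 𝒜 a (b • x) := by
  rw [inducedMk, tensorMk_mul]; rfl

lemma coe_smul_inducedMk (a : zeroPart 𝒜) (b : A) (x : M) :
    a • inducedMk 𝒜 b x = inducedMk 𝒜 (a * b) x := rfl

lemma inducedMk_add (a : A) (x y : M) :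
    inducedMk 𝒜 a (x + y) = inducedMk 𝒜 a x + inducedMk 𝒜 a y := by
  simp only [inducedMk, tensorMk, TensorProduct.tmul_add, map_add]

lemma inducedMk_zero_left (x : M) : inducedMk 𝒜 0 x = 0 := by
  simp only [inducedMk, tensorMk, TensorProduct.zero_tmul, map_zero]

/-- If `u a` acts on `M` as the identity then `a ⊗ x` survives in the induced module. -/
lemma eq_zero_of_inducedMk_eq_zero {a u : A} (e : zeroPart 𝒜) (h : (e : A) * (u * a) = e) {x : M}
    (hx : e • x = x) (h0 : inducedMk 𝒜 a x = 0) : x = 0 := by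
  have h1 : tensorMk 𝒜 a x ∈ nullSocle 𝒜 M := (Submodule.Quotient.mk_eq_zero _).1 h0
  have h2 := tensorIndProj_eq_zero_of_mem_nullSocle 𝒜 ((nullSocle 𝒜 M).smul_mem ((e : A) * u) h1)
  rw [smul_tensorMk, mul_assoc, h, tensorIndProj_mk] at h2
  rw [← hx, ← h2]
  congr 1
  exact (Subtype.ext (DirectSum.decompose_of_mem_same 𝒜 e.2)).symm

lemma conjugate_eq_span (r : ZMod m) :
    conjugate 𝒜 M r = Submodule.span (zeroPart 𝒜) {t | ∃ (a : 𝒜 r) (x : M),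
      t = inducedMk 𝒜 (a : A) x} := by
  rw [conjugate, tensorComponent, Submodule.map_span]
  congr 1
  ext t
  constructor
  · rintro ⟨_, ⟨a, x, rfl⟩, rfl⟩
    exact ⟨a, x, rfl⟩
  · rintro ⟨a, x, rfl⟩
    exact ⟨_, ⟨a, x, rfl⟩, rfl⟩

/-- If `w ∈ A_r` commutes with `A₀` and is invertible on a block that acts on the simple module `M`
as the identity, then `M^r ≅ M`. -/
lemma nonempty_conjugate_equiv [IsSimpleModule (zeroPart 𝒜) M] {r : ZMod m} {w u : A}
    (hw : w ∈ gradedCentralizer 𝒜 r) (hu : u ∈ gradedCentralizer 𝒜 (-r)) (e : zeroPart 𝒜)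
    (huw : (e : A) * (u * w) = e) (he : ∀ x : M, e • x = x) :
    Nonempty (conjugate 𝒜 M r ≃ₗ[zeroPart 𝒜] M) := by
  let f : M →ₗ[zeroPart 𝒜] Induced 𝒜 M :=
    { toFun := fun x => inducedMk 𝒜 w x
      map_add' := inducedMk_add 𝒜 w
      map_smul' := fun b x => by
        rw [RingHom.id_apply, coe_smul_inducedMk, hw.2 _ b.2, inducedMk_mul] }
  have hf : Function.Injective f := by
    rw [← LinearMap.ker_eq_bot, eq_bot_iff]
    intro x hx
    exact eq_zero_of_inducedMk_eq_zero 𝒜 e huw (he x) hx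
  have hrange : LinearMap.range f = conjugate 𝒜 M r := by
    rw [conjugate_eq_span]
    apply le_antisymm
    · rintro _ ⟨x, rfl⟩
      exact Submodule.subset_span ⟨⟨w, hw.1⟩, x, rfl⟩
    · refine Submodule.span_le.2 ?_
      rintro _ ⟨a, x, rfl⟩
      -- On the block `a = (a u) w = w (a u)`, so `a ⊗ x = w ⊗ (a u) x` lies in the range.
      have hau : (a : A) * u ∈ 𝒜 0 := mul_mem_zero 𝒜 a.2 hu.1
      refine ⟨(⟨(a : A) * u, hau⟩ : zeroPart 𝒜) • x, ?_⟩
      change inducedMk 𝒜 w _ = _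
      rw [← inducedMk_mul, ← hw.2 _ hau, ← he x, ← inducedMk_mul, ← inducedMk_mul, mul_assoc,
        ← hw.2 _ e.2, mul_assoc, ← mul_assoc u, ← hu.2 _ e.2, mul_assoc, huw]
  exact ⟨((LinearEquiv.ofInjective f hf).trans (LinearEquiv.ofEq _ _ hrange)).symm⟩

variable [NeZero m]

/-- A simple module in a block with an invertible element of degree `1` that commutes with `A₀` is
invariant. -/
lemma isInvariant_of_gradedCentralizer [IsSimpleModule (zeroPart 𝒜) M] {w u : A}
    (hw : w ∈ gradedCentralizer 𝒜 1) (hu : u ∈ gradedCentralizer 𝒜 (-1)) (e : zeroPart 𝒜)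
    (huw : (e : A) * (u * w) = e) (he : ∀ x : M, e • x = x) :
    IsInvariant 𝒜 M := by
  -- Powers of elements inverse on the block are inverse there; below this is used with `u` on the
  -- left.
  have hpow : ∀ {w u : A} {s : ZMod m} (_ : w ∈ gradedCentralizer 𝒜 s)
      (_ : (e : A) * (w * u) = e) (k : ℕ), (e : A) * (w ^ k * u ^ k) = e := by
    intro w u s hw hwu k
    induction k with
    | zero => simp
    | succ k ih =>
      have h1 : (e : A) * w ^ k = w ^ k * e := (gradedCentralizer.pow_mem hw k).2 _ e.2
      rw [pow_succ, pow_succ', mul_assoc, ← mul_assoc w, ← mul_assoc, h1, mul_assoc,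
        ← mul_assoc (e : A), hwu, ← mul_assoc, ← h1, mul_assoc, ih]
  intro r
  -- Since `1` generates `ZMod m`, powers of a degree-`1` element reach every degree `r`.
  have h1 := gradedCentralizer.pow_mem hw r.val
  have h2 := gradedCentralizer.pow_mem hu r.val
  rw [ZMod.natCast_zmod_val, mul_one] at h1
  rw [ZMod.natCast_zmod_val, mul_neg, mul_one] at h2
  exact nonempty_conjugate_equiv 𝒜 h1 h2 e (hpow hu huw _) he

omit [NeZero m] in
/-- If `M^r` is isomorphic to the non-zero module `M` on which `e` acts as the identity, then
`e A_r e` is not zero. -/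
lemma exists_mul_mul_ne_zero [Nontrivial M] {r : ZMod m}
    (f : conjugate 𝒜 M r ≃ₗ[zeroPart 𝒜] M) (e : zeroPart 𝒜) (he : ∀ x : M, e • x = x) :
    ∃ a ∈ 𝒜 r, (e : A) * a * e ≠ 0 := by
  by_contra! h
  obtain ⟨x, hx⟩ := exists_ne (0 : M)
  apply hx
  -- The extra factor `b` makes the claim stable under scalars in the span induction.
  have hconj : ∀ t ∈ conjugate 𝒜 M r, ∀ b : zeroPart 𝒜, (e * b) • t = 0 := by
    intro t ht
    rw [conjugate_eq_span] at ht
    induction ht using Submodule.span_induction with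
    | mem t ht =>
      obtain ⟨a, y, rfl⟩ := ht
      intro b
      rw [coe_smul_inducedMk, ← he y, ← inducedMk_mul]
      have : ((e * b : zeroPart 𝒜) : A) * a * e = 0 := by
        have := h _ (zeroPart_mul_mem 𝒜 b a)
        rw [← this]; simp [mul_assoc]
      rw [this, inducedMk_zero_left]
    | zero => intro b; exact smul_zero _
    | add s t _ _ hs ht => intro b; rw [smul_add, hs, ht, add_zero]
    | smul c t _ ht => intro b; rw [← mul_smul, mul_assoc]; exact ht _
  have h0 : e • f.symm x = 0 := by
    have := hconj _ (f.symm x).2 1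
    rw [mul_one] at this
    exact Subtype.ext this
  rw [← map_smul, he, LinearEquiv.map_eq_zero_iff] at h0
  exact h0

/-! ### Invariance of a simple module in terms of the centralizer -/

variable {𝒜}
variable {n : ℕ} {d : Fin n → ℕ} [∀ i, NeZero (d i)] (E : MatrixUnits ℂ (zeroPart 𝒜) d)

omit [NeZero m] [∀ i, NeZero (d i)] in
/-- A non-zero sub-bimodule of `A_r` over a matrix block contains a non-zero element that commutes
with `A₀`. -/
lemma exists_gradedCentralizer_idem_mul_ne_zero {r : ZMod m} {a : A} (ha : a ∈ 𝒜 r) {i : Fin n}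
    (h : (E.idem i : A) * a * E.idem i ≠ 0) :
    ∃ w ∈ gradedCentralizer 𝒜 r, (E.idem i : A) * w ≠ 0 := by
  let U : Fin (d i) → Fin (d i) → A := fun p q => (E.unit i p q : A)
  have hU : ∀ p q s, U p q * U q s = U p s := fun p q s =>
    congrArg Subtype.val (E.mul_same i p q s)
  have hU0 : ∀ p q s t, q ≠ s → U p q * U s t = 0 := fun p q s t h =>
    congrArg Subtype.val (E.mul_ne i p q s t h)
  have hidem : (E.idem i : A) = ∑ p, U p p := by
    rw [MatrixUnits.idem]
    exact map_sum (zeroPart 𝒜).val _ _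
  obtain ⟨p, q, hpq⟩ : ∃ p q, U p p * a * U q q ≠ 0 := by
    by_contra! h0
    apply h
    rw [hidem, Finset.sum_mul, Finset.sum_mul]
    refine Finset.sum_eq_zero fun p _ => ?_
    rw [Finset.mul_sum]
    exact Finset.sum_eq_zero fun q _ => h0 p q
  have hmem : ∀ b s c t, U b s * a * U c t ∈ 𝒜 r := fun b s c t =>
    mul_zeroPart_mem 𝒜 ⟨_, zeroPart_mul_mem 𝒜 (E.unit i b s) ⟨a, ha⟩⟩ (E.unit i c t)
  -- Averaging over the matrix units: `E_{bc} w` and `w E_{bc}` both equal `E_{bp} a E_{qc}`.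
  let w := ∑ k, U k p * a * U q k
  have hl : ∀ b c, U b c * w = U b p * a * U q c := by
    intro b c
    rw [Finset.mul_sum, Finset.sum_eq_single c]
    · rw [← mul_assoc, ← mul_assoc, hU]
    · intro k _ hk
      rw [← mul_assoc, ← mul_assoc, hU0 _ _ _ _ hk.symm, zero_mul, zero_mul]
    · simp
  have hr : ∀ b c, w * U b c = U b p * a * U q c := by
    intro b c
    rw [Finset.sum_mul, Finset.sum_eq_single b]
    · rw [mul_assoc, hU]
    · intro k _ hk
      rw [mul_assoc, hU0 _ _ _ _ hk, mul_zero]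
    · simp
  refine ⟨w, ⟨Submodule.sum_mem _ fun k _ => hmem _ _ _ _, fun b hb => ?_⟩, fun h0 => hpq ?_⟩
  · refine E.linear_ext (f := LinearMap.mulRight ℂ w ∘ₗ (zeroPart 𝒜).val.toLinearMap)
      (g := LinearMap.mulLeft ℂ w ∘ₗ (zeroPart 𝒜).val.toLinearMap) (fun j b c => ?_) ⟨b, hb⟩
    change (E.unit j b c : A) * w = w * (E.unit j b c : A)
    by_cases hij : j = i
    · subst hij
      exact (hl b c).trans (hr b c).symm
    · have h1 : ∀ s t, (E.unit j b c : A) * U s t = 0 := fun s t =>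
        congrArg Subtype.val (E.mul_block_ne j i hij b c s t)
      have h2 : ∀ s t, U s t * (E.unit j b c : A) = 0 := fun s t =>
        congrArg Subtype.val (E.mul_block_ne i j (Ne.symm hij) s t b c)
      simp only [w, Finset.mul_sum, Finset.sum_mul]
      rw [Finset.sum_eq_zero, Finset.sum_eq_zero]
      · intro k _
        rw [mul_assoc, h2, mul_zero]
      · intro k _
        rw [← mul_assoc, ← mul_assoc, h1, zero_mul, zero_mul]
  · have h1 : U p q * (E.idem i : A) = U p q := congrArg Subtype.val (E.unit_mul_idem i p q)
    rw [← hl p q, ← h1, mul_assoc, h0, mul_zero]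

variable [FiniteDimensional ℂ A] [StarRing A] [StarModule ℂ A] {lam₀ : zeroPart 𝒜 →ₗ[ℂ] ℂ}

/-- Invariance in the single degree `-1` already yields `w`; its block inverse has degree `1`, and
the powers of that inverse give all the other degrees. -/
lemma IsGradedFrobeniusStar.isInvariant_iff (hA : IsGradedFrobeniusStar 𝒜 lam₀)
    [IsSimpleModule (zeroPart 𝒜) M] {i : Fin n} {x : M} (hx : E.unit i 0 0 • x ≠ 0) :
    IsInvariant 𝒜 M ↔ ∃ w ∈ gradedCentralizer 𝒜 (-1), (E.idem i : A) * w ≠ 0 := by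
  have he := E.idem_smul_eq hx
  have : Nontrivial M := IsSimpleModule.nontrivial (zeroPart 𝒜) M
  constructor
  · intro h
    obtain ⟨f⟩ := h (-1)
    obtain ⟨a, ha, ha0⟩ := exists_mul_mul_ne_zero 𝒜 f _ he
    exact exists_gradedCentralizer_idem_mul_ne_zero E ha ha0
  · rintro ⟨w, hw, hw0⟩
    obtain ⟨u, hu, h1, h2⟩ := hA.exists_star_mul_eq E hw hw0
    rw [neg_neg] at hu
    exact isInvariant_of_gradedCentralizer 𝒜 hu hw _ h1 he

/-- The columns represent each simple class exactly once, so the invariant classes are the injective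
image of the blocks that meet the centralizer. -/
lemma IsGradedFrobeniusStar.invariantSim_finite_and_ncard (hA : IsGradedFrobeniusStar 𝒜 lam₀) :
    (invariantSim 𝒜).Finite ∧ (invariantSim 𝒜).ncard =
      {i | ∃ w ∈ gradedCentralizer 𝒜 (-1), (E.idem i : A) * w ≠ 0}.ncard := by
  let S : Fin n → Sim (zeroPart 𝒜) := fun i => Quotient.mk (simpleSetoid (zeroPart 𝒜))
    ⟨ModuleCat.of (zeroPart 𝒜) (E.column i), E.isSimpleModule_column i⟩
  have hS : Function.Injective S := by
    intro i j hij
    obtain ⟨f⟩ := Quotient.exact hij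
    exact E.eq_of_column_equiv f
  have himage : invariantSim 𝒜 =
      S '' {i | ∃ w ∈ gradedCentralizer 𝒜 (-1), (E.idem i : A) * w ≠ 0} := by
    ext c
    constructor
    · rintro ⟨⟨N, hN⟩, rfl, hinv⟩
      have : Nontrivial N := IsSimpleModule.nontrivial (zeroPart 𝒜) N
      obtain ⟨i, x, hx⟩ := E.exists_unit_smul_ne_zero (M := N)
      exact ⟨i, (hA.isInvariant_iff E hx).1 hinv, Quotient.sound (E.nonempty_equiv_column hx)⟩
    · rintro ⟨i, hi, rfl⟩
      exact ⟨_, rfl, (hA.isInvariant_iff E (E.unit_smul_column_ne_zero i)).2 hi⟩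
  rw [himage]
  exact ⟨(Set.toFinite _).image S, Set.ncard_image_of_injective _ hS⟩

end InducedModule

end TwistedClass

end

theorem corollary4p16 {m : ℕ} [NeZero m] {A : Type u} [Ring A] [Algebra ℂ A]
    [FiniteDimensional ℂ A] [StarRing A] [StarModule ℂ A]
    (𝒜 : ZMod m → Submodule ℂ A) [GradedAlgebra 𝒜]
    (lam₀ : TwistedClass.zeroPart 𝒜 →ₗ[ℂ] ℂ)
    (hA : TwistedClass.IsGradedFrobeniusStar 𝒜 lam₀) :
    (TwistedClass.invariantSim 𝒜).Finite ∧
      Module.finrank ℂ (TwistedClass.twistedClassFunctionals 𝒜 1) =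
        (TwistedClass.invariantSim 𝒜).ncard := by
  have := hA.isSemisimpleRing
  obtain ⟨n, d, hd, ⟨E⟩⟩ := TwistedClass.exists_matrixUnits ℂ (TwistedClass.zeroPart 𝒜)
  obtain ⟨hfin, hcard⟩ := hA.invariantSim_finite_and_ncard E
  exact ⟨hfin, by
    rw [hcard, hA.finrank_twistedClassFunctionals, hA.finrank_gradedCentralizer E]⟩
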